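/- Let $G$ be a finite simple connected graph with at least two vertices, minimum degree $\delta(G)$ and maximum degree $\Delta$. Then $$\delta(G)\leq \kappa^+(G)\leq rvd(G)\leq \chi_i(G)\leq \Delta(\Delta-1)+1.$$ Here the notions are as follows; vertex-colorings need not be proper. - For distinct nonadjacent vertices $x,y$ of a graph $H$, the local connectivity $\kappa_H(x,y)$ is the minimum size of a set $S\subseteq V(H)\setminus\{x,y\}$ such that $x$ and $y$ lie in different components of $H-S$. For adjacent vertices $x,y$ of $H$, $\kappa_H(x,y)=\kappa_{H-xy}(x,y)+1$, where $H-xy$ is $H$ with the edge $xy$ deleted. The upper connectivity $\kappa^+(G)$ is the maximum of $\kappa_G(x,y)$ over all pairs of distinct vertices $x,y$ of $G$. - For distinct vertices $x,y$ of $G$, an $x$-$y$ vertex-cut is a set $S\subseteq V(G)\setminus\{x,y\}$ such that $x$ and $y$ lie in different components of $G-S$ if $x,y$ are nonadjacent, and of $(G-xy)-S$ if $x,y$ are adjacent. Given a vertex-coloring of $G$, a set of vertices is rainbow if no two of its vertices have the same color. An $x$-$y$ vertex-cut $S$ is an $x$-$y$ rainbow vertex-cut if either $x,y$ are nonadjacent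 and $S$ is rainbow, or $x,y$ are adjacent and $S\cup\{x\}$ or $S\cup\{y\}$ is rainbow. The rainbow vertex-disconnection number $rvd(G)$ is the minimum number of colors in a vertex-coloring of $G$ for which every two distinct vertices $x,y$ have an $x$-$y$ rainbow vertex-cut. - The injective chromatic number $\chi_i(G)$ is the minimum number of colors in a vertex-coloring of $G$ in which any two distinct vertices with a common neighbor have different colors. -/

import Mathlib

namespace RainbowVertexDisconnection

variable {V : Type*}

/-- `x` and `y` are vertices of `H - S` and belong to different components of `H - S`. -/
def Separates (H : SimpleGraph V) (x y : V) (S : Finset V) : Prop :=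
  ∃ (hx : x ∉ S) (hy : y ∉ S),
    (H.induce {v | v ∉ S}).connectedComponentMk ⟨x, hx⟩ ≠
      (H.induce {v | v ∉ S}).connectedComponentMk ⟨y, hy⟩

/-- The graph `G - xy`: only the edge `xy` is deleted. -/
abbrev deleteEdge (G : SimpleGraph V) (x y : V) : SimpleGraph V :=
  G.deleteEdges {s(x, y)}

/-- `S` is an `x`-`y` vertex-cut: it separates `x` from `y` in `G` if they are nonadjacent,
and in `G - xy` if they are adjacent. -/
def IsVertexCut (G : SimpleGraph V) (x y : V) (S : Finset V) : Prop :=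
  (¬ G.Adj x y → Separates G x y S) ∧ (G.Adj x y → Separates (deleteEdge G x y) x y S)

/-- No two vertices of `A` have the same color. -/
def IsRainbow {C : Type*} (c : V → C) (A : Set V) : Prop :=
  ∀ u ∈ A, ∀ v ∈ A, u ≠ v → c u ≠ c v

/-- An `x`-`y` rainbow vertex-cut: an `x`-`y` vertex-cut `S` such that `S` is rainbow if `x`, `y`
are nonadjacent, and `S + x` or `S + y` is rainbow if they are adjacent. -/
def IsRainbowVertexCut {C : Type*} (G : SimpleGraph V) (c : V → C) (x y : V) (S : Finset V) :
    Prop :=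
  IsVertexCut G x y S ∧
    (¬ G.Adj x y → IsRainbow c (S : Set V)) ∧
    (G.Adj x y → IsRainbow c (insert x (S : Set V)) ∨ IsRainbow c (insert y (S : Set V)))

/-- A rainbow vertex-disconnection coloring (adjacent vertices may share a color). -/
def IsRVDColoring {C : Type*} (G : SimpleGraph V) (c : V → C) : Prop :=
  ∀ x y : V, x ≠ y → ∃ S : Finset V, IsRainbowVertexCut G c x y S

/-- The rainbow vertex-disconnection number `rvd(G)`. -/
noncomputable def rvd (G : SimpleGraph V) : ℕ :=
  sInf {k : ℕ | ∃ c : V → Fin k, IsRVDColoring G c}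

/-- An injective coloring: distinct vertices with a common neighbor get different colors. -/
def IsInjectiveColoring {C : Type*} (G : SimpleGraph V) (c : V → C) : Prop :=
  ∀ u v : V, u ≠ v → (∃ w, G.Adj w u ∧ G.Adj w v) → c u ≠ c v

/-- The injective chromatic number `χ_i(G)`. -/
noncomputable def injectiveChromaticNumber (G : SimpleGraph V) : ℕ :=
  sInf {k : ℕ | ∃ c : V → Fin k, IsInjectiveColoring G c}

/-- The minimum number of vertices required to separate `x` from `y` in `H`
(for distinct, nonadjacent `x` and `y`). -/
noncomputable def minSeparator (H : SimpleGraph V) (x y : V) : ℕ :=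
  sInf {k : ℕ | ∃ S : Finset V, Separates H x y S ∧ S.card = k}

open Classical in
/-- The local connectivity `κ_G(x, y)` of two distinct vertices. -/
noncomputable def localConnectivity (G : SimpleGraph V) (x y : V) : ℕ :=
  if G.Adj x y then minSeparator (deleteEdge G x y) x y + 1 else minSeparator G x y

/-- The upper connectivity `κ⁺(G)`: the maximum of `κ_G(x, y)` over pairs of distinct vertices. -/
noncomputable def upperConnectivity (G : SimpleGraph V) : ℕ :=
  sSup {k : ℕ | ∃ x y : V, x ≠ y ∧ localConnectivity G x y = k}

/-! The minima and the maximum above are attained on finite graphs, so that no convention on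
`sInf ∅` or on `sSup` of an unbounded set is involved. -/

theorem exists_separates [Fintype V] (H : SimpleGraph V) {x y : V} (hne : x ≠ y)
    (h : ¬ H.Adj x y) : ∃ S : Finset V, x ∉ S ∧ y ∉ S ∧ Separates H x y S := by
  classical
  refine ⟨Finset.univ \ {x, y}, by simp, by simp, by simp, by simp, ?_⟩
  rw [Ne, SimpleGraph.ConnectedComponent.eq]
  rintro ⟨w⟩
  cases w with
  | nil => exact hne rfl
  | @cons _ z _ hz _ =>
    have hz1 : H.Adj x z.1 := hz
    have hz2 : z.1 = x ∨ z.1 = y := by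
      have := z.2
      simp only [Set.mem_ofPred_eq, Finset.mem_sdiff, Finset.mem_univ, true_and, not_not,
        Finset.mem_insert, Finset.mem_singleton] at this
      exact this
    rcases hz2 with hz2 | hz2
    · rw [hz2] at hz1
      exact H.loopless.irrefl x hz1
    · rw [hz2] at hz1
      exact h hz1

theorem not_adj_deleteEdge (G : SimpleGraph V) (x y : V) : ¬ (deleteEdge G x y).Adj x y := by
  simp [deleteEdge]

theorem isRVDColoring_of_injective [Fintype V] {C : Type*} (G : SimpleGraph V) {c : V → C}
    (hc : Function.Injective c) : IsRVDColoring G c := by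
  intro x y hne
  have hr : ∀ A : Set V, IsRainbow c A := fun A u _ v _ huv e => huv (hc e)
  by_cases h : G.Adj x y
  · obtain ⟨S, _, _, hS⟩ := exists_separates _ hne (not_adj_deleteEdge G x y)
    exact ⟨S, ⟨fun h' => absurd h h', fun _ => hS⟩, fun _ => hr _, fun _ => Or.inl (hr _)⟩
  · obtain ⟨S, _, _, hS⟩ := exists_separates G hne h
    exact ⟨S, ⟨fun _ => hS, fun h' => absurd h' h⟩, fun _ => hr _, fun _ => Or.inl (hr _)⟩

theorem exists_isRVDColoring_rvd [Fintype V] (G : SimpleGraph V) :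
    ∃ c : V → Fin (rvd G), IsRVDColoring G c :=
  Nat.sInf_mem (s := {k : ℕ | ∃ c : V → Fin k, IsRVDColoring G c})
    ⟨_, _, isRVDColoring_of_injective G (Fintype.equivFin V).injective⟩

theorem exists_isInjectiveColoring [Fintype V] (G : SimpleGraph V) :
    ∃ c : V → Fin (injectiveChromaticNumber G), IsInjectiveColoring G c :=
  Nat.sInf_mem (s := {k : ℕ | ∃ c : V → Fin k, IsInjectiveColoring G c})
    ⟨_, Fintype.equivFin V, fun _ _ huv _ e => huv ((Fintype.equivFin V).injective e)⟩

theorem exists_card_eq_minSeparator [Fintype V] (H : SimpleGraph V) {x y : V} (hne : x ≠ y)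
    (h : ¬ H.Adj x y) : ∃ S : Finset V, Separates H x y S ∧ S.card = minSeparator H x y :=
  Nat.sInf_mem (s := {k : ℕ | ∃ S : Finset V, Separates H x y S ∧ S.card = k}) <| by
    obtain ⟨S, _, _, hS⟩ := exists_separates H hne h
    exact ⟨_, S, hS, rfl⟩

theorem bddAbove_localConnectivity [Finite V] (G : SimpleGraph V) :
    BddAbove {k : ℕ | ∃ x y : V, x ≠ y ∧ localConnectivity G x y = k} := by
  apply Set.Finite.bddAbove
  apply (Set.finite_range fun p : V × V => localConnectivity G p.1 p.2).subset
  rintro k ⟨x, y, _, rfl⟩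
  exact ⟨(x, y), rfl⟩

end RainbowVertexDisconnection

namespace RainbowVertexDisconnection

open Finset

/-! ### Upper bound by greedy coloring -/

section Greedy

/-! The upper bounds are local. Greedy coloring gives `χ_i`; an injective coloring makes every
neighborhood rainbow, and `N(x) \ {y}` cuts `x` from `y`; a rainbow cut has no more vertices than
there are colors. The lower bound `δ ≤ κ⁺` uses a maximum adjacency ordering whose last two vertices
are `x`, `y`: any separator of `x` and `y` has at least as many vertices as `y` has neighbors before
`x`, so `κ(x, y) ≥ deg y ≥ δ`. The core is `IsMaxAdjPrefix.exists_side`, an induction along the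
ordering. -/

/-- Greedy coloring: if every vertex conflicts with at most `D` vertices, then `D + 1` colors
suffice. -/
theorem exists_greedy_coloring {V : Type*} [Fintype V] (R : V → V → Prop) (hR : ∀ u v, R u v → R v u)
    (N : V → Finset V) (D : ℕ) (hN : ∀ u v, u ≠ v → R u v → v ∈ N u) (hD : ∀ v, #(N v) ≤ D) :
    ∃ c : V → Fin (D + 1), ∀ u v, u ≠ v → R u v → c u ≠ c v := by
  classical
  suffices h : ∀ s : Finset V, ∃ c : V → Fin (D + 1),
      ∀ u ∈ s, ∀ v ∈ s, u ≠ v → R u v → c u ≠ c v by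
    obtain ⟨c, hc⟩ := h univ
    exact ⟨c, fun u v => hc u (mem_univ u) v (mem_univ v)⟩
  intro s
  induction s using Finset.induction_on with
  | empty => exact ⟨fun _ => 0, by simp⟩
  | insert a s ha ih =>
    obtain ⟨c, hc⟩ := ih
    obtain ⟨k, hk⟩ : ∃ k, k ∉ (N a).image c := by
      by_contra! h
      have h1 : #(univ : Finset (Fin (D + 1))) ≤ #((N a).image c) :=
        card_le_card fun k _ => h k
      have h2 := card_image_le (s := N a) (f := c)
      have h3 := hD a
      rw [card_univ, Fintype.card_fin] at h1
      omega
    have hka : ∀ v, a ≠ v → R a v → k ≠ c v := fun v hv hr e =>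
      hk (e ▸ mem_image_of_mem c (hN a v hv hr))
    refine ⟨Function.update c a k, fun u hu v hv huv hr => ?_⟩
    by_cases hua : u = a
    · subst hua
      rw [Function.update_self, Function.update_of_ne huv.symm]
      exact hka v huv hr
    · by_cases hva : v = a
      · subst hva
        rw [Function.update_self, Function.update_of_ne hua]
        exact (hka u huv.symm (hR u v hr)).symm
      · rw [Function.update_of_ne hua, Function.update_of_ne hva]
        exact hc u (mem_of_mem_insert_of_ne hu hua) v (mem_of_mem_insert_of_ne hv hva) huv hr

/-- A conflicting vertex is reached through one of at most `Δ` neighbors `w` of `v`; since `v` is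
itself a neighbor of `w`, each `w` gives at most `Δ - 1` others. -/
theorem injectiveChromaticNumber_le {V : Type*} [Fintype V] (G : SimpleGraph V)
    [DecidableRel G.Adj] :
    injectiveChromaticNumber G ≤ G.maxDegree * (G.maxDegree - 1) + 1 := by
  classical
  refine Nat.sInf_le ?_
  obtain ⟨c, hc⟩ := exists_greedy_coloring (fun u v => ∃ w, G.Adj w u ∧ G.Adj w v)
    (fun _ _ ⟨w, h₁, h₂⟩ => ⟨w, h₂, h₁⟩)
    (fun v => (G.neighborFinset v).biUnion fun w => (G.neighborFinset w).erase v)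
    (G.maxDegree * (G.maxDegree - 1))
    (fun u v huv ⟨w, h₁, h₂⟩ => by
      simp only [mem_biUnion, SimpleGraph.mem_neighborFinset, mem_erase]
      exact ⟨w, h₁.symm, huv.symm, h₂⟩)
    (fun v => by
      refine (card_biUnion_le_card_mul _ _ (G.maxDegree - 1) fun w hw => ?_).trans
        (Nat.mul_le_mul_right _ (G.degree_le_maxDegree v))
      rw [SimpleGraph.mem_neighborFinset] at hw
      rw [card_erase_of_mem (by simpa using hw.symm)]
      exact Nat.sub_le_sub_right (G.degree_le_maxDegree w) 1)
  exact ⟨c, hc⟩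

end Greedy

/-! ### Rainbow cuts and numbers of colors -/

section RainbowCuts

variable {V : Type*}

/-- If `S` misses `x` and `y` and contains all neighbors of `x` in `H`, it separates `x`, `y`. -/
theorem separates_of_neighbors_subset {H : SimpleGraph V} {x y : V} {S : Finset V} (hne : x ≠ y)
    (hx : x ∉ S) (hy : y ∉ S) (hS : ∀ z, H.Adj x z → z ∈ S) : Separates H x y S := by
  refine ⟨hx, hy, ?_⟩
  rw [Ne, SimpleGraph.ConnectedComponent.eq]
  rintro ⟨w⟩
  cases w with
  | nil => exact hne rfl
  | @cons _ z _ hz _ => exact z.2 (hS z.1 hz)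

/-- The cut is `N(x) \ {y}`, whose vertices share the neighbor `x`. If `x` and `y` are adjacent, `y`
also lies in `N(x)`, so the cut together with `y` is rainbow. -/
theorem IsInjectiveColoring.isRVDColoring [Fintype V] {C : Type*} {G : SimpleGraph V} {c : V → C}
    (hc : IsInjectiveColoring G c) : IsRVDColoring G c := by
  classical
  intro x y hne
  have hS : ∀ z, z ∈ (G.neighborFinset x).erase y ↔ z ≠ y ∧ G.Adj x z := by simp
  have hx : x ∉ (G.neighborFinset x).erase y := by simp
  have hy : y ∉ (G.neighborFinset x).erase y := by simp
  refine ⟨(G.neighborFinset x).erase y, ⟨fun h => ?_, fun h => ?_⟩, fun h => ?_, fun h => ?_⟩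
  · exact separates_of_neighbors_subset hne hx hy fun z hz =>
      (hS z).2 ⟨fun e => h (e ▸ hz), hz⟩
  · refine separates_of_neighbors_subset hne hx hy fun z hz => (hS z).2 ⟨?_, ?_⟩
    · rintro rfl
      exact not_adj_deleteEdge G x z hz
    · exact SimpleGraph.deleteEdges_le _ hz
  · intro u hu v hv huv
    exact hc u v huv ⟨x, ((hS u).1 hu).2, ((hS v).1 hv).2⟩
  · have hadj : ∀ u ∈ insert y (((G.neighborFinset x).erase y : Finset V) : Set V),
        G.Adj x u := by
      rintro u (rfl | hu)
      · exact h
      · exact ((hS u).1 hu).2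
    exact Or.inr fun u hu v hv huv => hc u v huv ⟨x, hadj u hu, hadj v hv⟩

theorem rvd_le_injectiveChromaticNumber [Fintype V] (G : SimpleGraph V) :
    rvd G ≤ injectiveChromaticNumber G := by
  obtain ⟨c, hc⟩ := exists_isInjectiveColoring G
  exact Nat.sInf_le ⟨c, hc.isRVDColoring⟩

theorem IsRainbow.card_le {k : ℕ} {c : V → Fin k} {A : Finset V} (h : IsRainbow c (A : Set V)) :
    #A ≤ k := by
  have := card_le_card_of_injOn (t := univ) c (fun _ _ => mem_univ _) fun u hu v hv e =>
    by_contra fun huv => h u hu v hv huv e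
  simpa using this

theorem minSeparator_le {H : SimpleGraph V} {x y : V} {S : Finset V} (h : Separates H x y S) :
    minSeparator H x y ≤ #S :=
  Nat.sInf_le ⟨S, h, rfl⟩

/-- For adjacent `x`, `y`, the endpoint added to the rainbow cut accounts for the `+ 1` in the local
connectivity. -/
theorem upperConnectivity_le_rvd [Fintype V] [Nontrivial V] (G : SimpleGraph V) :
    upperConnectivity G ≤ rvd G := by
  classical
  obtain ⟨c, hc⟩ := exists_isRVDColoring_rvd G
  obtain ⟨a, b, hab⟩ := exists_pair_ne V
  refine csSup_le ⟨_, a, b, hab, rfl⟩ ?_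
  rintro k ⟨x, y, hne, rfl⟩
  obtain ⟨S, ⟨hcut, hcut'⟩, hr, hr'⟩ := hc x y hne
  unfold localConnectivity
  split_ifs with h
  · have hsep := hcut' h
    have hle := minSeparator_le hsep
    obtain ⟨hx, hy, -⟩ := hsep
    refine (Nat.succ_le_succ hle).trans ?_
    rcases hr' h with hr' | hr'
    · rw [← coe_insert] at hr'
      simpa [card_insert_of_notMem hx] using hr'.card_le
    · rw [← coe_insert] at hr'
      simpa [card_insert_of_notMem hy] using hr'.card_le
  · exact (minSeparator_le (hcut h)).trans (hr h).card_le

end RainbowCuts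

/-! ### Maximum adjacency orderings and the minimum degree -/

section MaximumAdjacency

variable {V : Type*}

open Classical in
/-- The number of neighbors of `v` in `W`. -/
noncomputable def adjCount (G : SimpleGraph V) (W : Finset V) (v : V) : ℕ :=
  #{w ∈ W | G.Adj v w}

open Classical in
/-- `W` is the set of the first vertices of a maximum adjacency ordering of `G`: each next vertex
has the most neighbors among the vertices already chosen. -/
inductive IsMaxAdjPrefix (G : SimpleGraph V) : Finset V → Prop
  | empty : IsMaxAdjPrefix G ∅
  | insert {W : Finset V} {z : V} (hW : IsMaxAdjPrefix G W) (hz : z ∉ W)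
      (hmax : ∀ v, v ∉ W → adjCount G W v ≤ adjCount G W z) : IsMaxAdjPrefix G (insert z W)

open Classical in
theorem exists_max_adjCount [Fintype V] (G : SimpleGraph V) {W : Finset V}
    (hW : #W < Fintype.card V) :
    ∃ z, z ∉ W ∧ ∀ v, v ∉ W → adjCount G W v ≤ adjCount G W z := by
  have hne : (Wᶜ).Nonempty := by
    rw [← card_pos, card_compl]
    omega
  obtain ⟨z, hz, hmax⟩ := exists_max_image Wᶜ (adjCount G W) hne
  exact ⟨z, mem_compl.1 hz, fun v hv => hmax v (mem_compl.2 hv)⟩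

theorem exists_isMaxAdjPrefix [Fintype V] (G : SimpleGraph V) (n : ℕ) (hn : n ≤ Fintype.card V) :
    ∃ W : Finset V, IsMaxAdjPrefix G W ∧ #W = n := by
  classical
  induction n with
  | zero => exact ⟨∅, .empty, rfl⟩
  | succ n ih =>
    obtain ⟨W, hW, hcard⟩ := ih (by omega)
    obtain ⟨z, hz, hmax⟩ := exists_max_adjCount G (W := W) (by omega)
    exact ⟨insert z W, hW.insert hz hmax, by rw [card_insert_of_notMem hz, hcard]⟩

theorem adjCount_insert [DecidableEq V] (G : SimpleGraph V) [DecidableRel G.Adj] {W : Finset V} {z : V} (hz : z ∉ W) (v : V) :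
    adjCount G (insert z W) v = adjCount G W v + if G.Adj v z then 1 else 0 := by
  unfold adjCount
  rw [filter_insert]
  split_ifs with h
  · rw [card_insert_of_notMem (by simp [hz])]
  · rfl

open Classical in
/-- Suppose `W` begins a maximum adjacency ordering and `side` is constant along edges that avoid
`S` and meet `W`. Then the later vertices on one of the two sides have at most `|S ∩ W|` neighbors
in `W`. -/
theorem IsMaxAdjPrefix.exists_side {G : SimpleGraph V} {W : Finset V} (hW : IsMaxAdjPrefix G W)
    (S : Finset V) (side : V → Prop)
    (hside : ∀ a ∈ W, ∀ b, a ∉ S → b ∉ S → G.Adj b a → (side b ↔ side a)) :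
    ∃ p : Prop, ∀ v, v ∉ W → v ∉ S → (side v ↔ p) → adjCount G W v ≤ #(W ∩ S) := by
  induction hW with
  | empty => exact ⟨True, fun v _ _ _ => by simp [adjCount]⟩
  | @insert W z _ hz hmax ih =>
    obtain ⟨p, hp⟩ := ih fun a ha => hside a (mem_insert_of_mem ha)
    -- If `z ∈ S`, the bound grows by one and each count by at most one, so the same side works.
    by_cases hzS : z ∈ S
    · refine ⟨p, fun v hv hvS hvp => ?_⟩
      have h := hp v (fun h => hv (mem_insert_of_mem h)) hvS hvp
      rw [adjCount_insert G hz, insert_inter_of_mem hzS, card_insert_of_notMem (by simp [hz])]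
      split_ifs <;> omega
    -- Otherwise take the side opposite to `z`: its vertices outside `S` are not adjacent to `z`, so
    -- their counts do not change.
    · refine ⟨¬ side z, fun v hv hvS hvp => ?_⟩
      have hvW : v ∉ W := fun h => hv (mem_insert_of_mem h)
      have hadj : ¬ G.Adj v z := fun h => by
        have := hside z (mem_insert_self z W) v hzS hvS h
        tauto
      rw [adjCount_insert G hz, insert_inter_of_notMem hzS, if_neg hadj, add_zero]
      by_cases hv' : side v ↔ p
      · exact hp v hvW hvS hv'
      -- Here `z` lies on the old side `p`, so its count is already bounded, and `z` was chosen with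
      -- maximal count.
      · exact (hmax v hvW).trans (hp z hz hzS (by tauto))

/-- A separator of the last two vertices `x`, `y` of a maximum adjacency ordering, also after
deletion of a possible edge `xy`, has at least as many vertices as `y` has neighbors before. -/
theorem IsMaxAdjPrefix.adjCount_le_card {G H : SimpleGraph V} {W : Finset V}
    (hW : IsMaxAdjPrefix G W) {x y : V} (hx : x ∉ W) (hy : y ∉ W)
    (hmax : adjCount G W y ≤ adjCount G W x)
    (hGH : ∀ a ∈ W, ∀ b, G.Adj b a → H.Adj b a) {S : Finset V} (hS : Separates H x y S) :
    adjCount G W y ≤ #S := by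
  classical
  obtain ⟨hxS, hyS, hne⟩ := hS
  let side : V → Prop := fun v => ∃ h : v ∉ S,
    (H.induce {v | v ∉ S}).connectedComponentMk ⟨v, h⟩ =
      (H.induce {v | v ∉ S}).connectedComponentMk ⟨x, hxS⟩
  have hsx : side x := ⟨hxS, rfl⟩
  have hsy : ¬ side y := fun ⟨_, h⟩ => hne h.symm
  obtain ⟨p, hp⟩ := hW.exists_side S side fun a ha b haS hbS hab => by
    have h : (H.induce {v | v ∉ S}).Adj ⟨b, hbS⟩ ⟨a, haS⟩ := hGH a ha b hab
    have e := SimpleGraph.ConnectedComponent.sound h.reachable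
    exact ⟨fun ⟨_, h'⟩ => ⟨haS, e ▸ h'⟩, fun ⟨_, h'⟩ => ⟨hbS, e ▸ h'⟩⟩
  have hle : #(W ∩ S) ≤ #S := card_le_card inter_subset_right
  -- The side `p` contains exactly one of `x`, `y`; if it is `x`, maximality of `x` passes the bound
  -- on to `y`.
  by_cases h : p
  · exact hmax.trans ((hp x hx hxS (by tauto)).trans hle)
  · exact (hp y hy hyS (by tauto)).trans hle

theorem le_minSeparator [Fintype V] {H : SimpleGraph V} {x y : V} (hne : x ≠ y)
    (h : ¬ H.Adj x y) {k : ℕ} (hk : ∀ S, Separates H x y S → k ≤ #S) : k ≤ minSeparator H x y := by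
  obtain ⟨S, hS, hcard⟩ := exists_card_eq_minSeparator H hne h
  exact hcard ▸ hk S hS

/-- Some vertex `y` has local connectivity at least its degree with some other vertex `x`. -/
theorem exists_degree_le_localConnectivity [Fintype V] [Nontrivial V] (G : SimpleGraph V)
    [DecidableRel G.Adj] : ∃ x y : V, x ≠ y ∧ G.degree y ≤ localConnectivity G x y := by
  classical
  have hcard := Fintype.one_lt_card (α := V)
  obtain ⟨W, hW, hWc⟩ := exists_isMaxAdjPrefix G (Fintype.card V - 2) (by omega)
  obtain ⟨x, hx, hmax⟩ := exists_max_adjCount G (W := W) (by omega)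
  have hxW : #(insert x W) = Fintype.card V - 1 := by
    rw [card_insert_of_notMem hx]
    omega
  obtain ⟨y, hy, -⟩ := exists_max_adjCount G (W := insert x W) (by omega)
  have huniv : insert y (insert x W) = univ := by
    rw [← card_eq_iff_eq_univ, card_insert_of_notMem hy]
    omega
  rw [mem_insert, not_or] at hy
  obtain ⟨hyx, hyW⟩ := hy
  have hdeg : G.degree y = adjCount G W y + if G.Adj y x then 1 else 0 := by
    -- The zero term for the non-edge `yy` allows `y` to be inserted as well, so that the count runs
    -- over all vertices.
    rw [← adjCount_insert G hx, ← add_zero (adjCount _ _ _),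
      ← if_neg (c := G.Adj y y) (t := 1) (e := 0) G.irrefl,
      ← adjCount_insert G (by simp [hyx, hyW]), huniv]
    unfold adjCount
    rw [← G.card_neighborFinset_eq_degree]
    congr 1
    ext
    simp
  refine ⟨x, y, Ne.symm hyx, ?_⟩
  rw [hdeg]
  unfold localConnectivity
  by_cases h : G.Adj x y
  · rw [if_pos h, if_pos h.symm]
    refine Nat.succ_le_succ (le_minSeparator (Ne.symm hyx) (not_adj_deleteEdge G x y) fun S hS =>
      hW.adjCount_le_card hx hyW (hmax y hyW) (fun a ha b hba => ?_) hS)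
    rw [SimpleGraph.deleteEdges_adj]
    -- An edge with an end in `W` is not `xy`, so it survives the deletion.
    refine ⟨hba, fun e => ?_⟩
    rcases Sym2.eq_iff.1 (Set.mem_singleton_iff.1 e) with ⟨_, rfl⟩ | ⟨_, rfl⟩
    · exact hyW ha
    · exact hx ha
  · rw [if_neg h, if_neg fun h' => h h'.symm, add_zero]
    exact le_minSeparator (Ne.symm hyx) h fun S hS =>
      hW.adjCount_le_card hx hyW (hmax y hyW) (fun _ _ _ => id) hS

theorem minDegree_le_upperConnectivity [Fintype V] [Nontrivial V] (G : SimpleGraph V)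
    [DecidableRel G.Adj] : G.minDegree ≤ upperConnectivity G := by
  obtain ⟨x, y, hne, h⟩ := exists_degree_le_localConnectivity G
  exact (G.minDegree_le_degree y).trans
    (h.trans (le_csSup (bddAbove_localConnectivity G) ⟨x, y, hne, rfl⟩))

end MaximumAdjacency

end RainbowVertexDisconnection

theorem mainTheorem2 {V : Type*} [Fintype V] [Nontrivial V] (G : SimpleGraph V)
    [DecidableRel G.Adj] (hG : G.Connected) :
    G.minDegree ≤ RainbowVertexDisconnection.upperConnectivity G ∧
    RainbowVertexDisconnection.upperConnectivity G ≤ RainbowVertexDisconnection.rvd G ∧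
    RainbowVertexDisconnection.rvd G ≤
      RainbowVertexDisconnection.injectiveChromaticNumber G ∧
    RainbowVertexDisconnection.injectiveChromaticNumber G ≤
      G.maxDegree * (G.maxDegree - 1) + 1 :=
  ⟨RainbowVertexDisconnection.minDegree_le_upperConnectivity G,
    RainbowVertexDisconnection.upperConnectivity_le_rvd G,
    RainbowVertexDisconnection.rvd_le_injectiveChromaticNumber G,
    RainbowVertexDisconnection.injectiveChromaticNumber_le G⟩
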